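/- Let $k$ be a field and let $\mathcal{C}$ be a skeletally small, $k$-linear, Hom-finite, idempotent complete, triangulated category with suspension $\Sigma$. Let $\mathcal{X}\subseteq\mathcal{T}\subseteq\mathcal{C}$ be full subcategories, each closed under isomorphisms, finite direct sums and direct summands, and each contravariantly finite in $\mathcal{C}$ (every object $A$ of $\mathcal{C}$ admits a morphism $D\to A$ with $D$ in the subcategory, through which every morphism to $A$ from an object of the subcategory factors). Assume that $\mathcal{T}$ (and hence $\mathcal{X}$) is rigid, i.e. $\mathcal{C}(T,\Sigma T')=0$ for all $T,T'\in\mathcal{T}$. For $\mathcal{D}\in\{\mathcal{X},\mathcal{T}\}$ put $\mathbb{E}_{\mathcal{D}}(C,A)=\{\delta\in\mathcal{C}(C,\Sigma A) : \mathcal{C}(-,\delta)|_{\mathcal{D}}=0\}$. Let $K_0(\mathcal{C},\mathbb{E}_{\mathcal{D}},\mathfrak{s}_{\mathcal{D}})$ be the Grothendieck group of the corresponding relative extriangulated structure, that is, the quotient of the split Grothendieck group of $\mathcal{C}$ by the subgroup generated by all $[A]-[B]+[C]$ for which there is a triangle $A\to B\to C\xrightarrow{\delta}\Sigma A$ with $\delta\in\mathbb{E}_{\mathcal{D}}(C,A)$.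 Write $[C]_{\mathcal{D}}$ for the class of $C$ in this group, and let $$Q\colon K_0(\mathcal{C},\mathbb{E}_{\mathcal{T}},\mathfrak{s}_{\mathcal{T}})\to K_0(\mathcal{C},\mathbb{E}_{\mathcal{X}},\mathfrak{s}_{\mathcal{X}}),\qquad [C]_{\mathcal{T}}\mapsto[C]_{\mathcal{X}},$$ be the canonical surjection. Let $\operatorname{mod}\mathcal{T}$ be the abelian category of finitely presented additive functors $\mathcal{T}^{\mathrm{op}}\to\mathsf{Ab}$, and $K_0(\operatorname{mod}\mathcal{T})$ its Grothendieck group. Then there is a unique group homomorphism $\theta_{\mathcal{T}}\colon K_0(\operatorname{mod}\mathcal{T})\to K_0(\mathcal{C},\mathbb{E}_{\mathcal{T}},\mathfrak{s}_{\mathcal{T}})$ with $\theta_{\mathcal{T}}\big([\mathcal{C}(-,C)|_{\mathcal{T}}]\big)=[C]_{\mathcal{T}}+[\Sigma^{-1}C]_{\mathcal{T}}$ for all $C\in\mathcal{C}$, and $$\operatorname{Ker} Q=\big\langle\,\theta_{\mathcal{T}}([L]) \;\big|\; L\in\operatorname{mod}\mathcal{T}\text{ with } L|_{\mathcal{X}}=0\,\big\rangle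 .$$ -/

import Mathlib

open CategoryTheory CategoryTheory.Limits CategoryTheory.Pretriangulated

universe v u

set_option linter.unusedSectionVars false

namespace RelIndex

noncomputable section

/-! ### Split Grothendieck groups and Grothendieck groups of abelian categories -/

section GrothendieckGroups

variable (A : Type u) [Category.{v} A]

/-- The free abelian group on the isomorphism classes of objects of `A`. -/
abbrev FreeOnIso : Type u := FreeAbelianGroup (Quotient (isIsomorphicSetoid A))

variable {A} in
/-- The generator of `FreeOnIso A` given by the isomorphism class of `M`. -/
def freeClass (M : A) : FreeOnIso A :=
  FreeAbelianGroup.of (Quotient.mk (isIsomorphicSetoid A) M)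

/-- The relations `[M ⊞ N] - [M] - [N]`. -/
def splitRelations [HasZeroMorphisms A] [HasBinaryBiproducts A] : AddSubgroup (FreeOnIso A) :=
  AddSubgroup.closure {x | ∃ M N : A, x = freeClass (M ⊞ N) - freeClass M - freeClass N}

/-- The split Grothendieck group of an additive category. -/
abbrev SplitK0 [HasZeroMorphisms A] [HasBinaryBiproducts A] : Type u :=
  FreeOnIso A ⧸ splitRelations A

variable {A} in
/-- The class of an object in the split Grothendieck group. -/
def splitClass [HasZeroMorphisms A] [HasBinaryBiproducts A] (M : A) : SplitK0 A :=
  QuotientAddGroup.mk' (splitRelations A) (freeClass M)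

/-- The relations `[L] - [M] + [N]`, one for each short exact sequence
`0 ⟶ L ⟶ M ⟶ N ⟶ 0` in `A`. -/
def exactRelations [HasZeroMorphisms A] : AddSubgroup (FreeOnIso A) :=
  AddSubgroup.closure {x | ∃ S : ShortComplex A, S.ShortExact ∧
    x = freeClass S.X₁ - freeClass S.X₂ + freeClass S.X₃}

/-- The Grothendieck group of an abelian category (the definition makes sense as soon as
there are zero morphisms). -/
abbrev AbK0 [HasZeroMorphisms A] : Type u := FreeOnIso A ⧸ exactRelations A

variable {A} in
/-- The class of an object in the Grothendieck group. -/
def abClass [HasZeroMorphisms A] (M : A) : AbK0 A :=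
  QuotientAddGroup.mk' (exactRelations A) (freeClass M)

end GrothendieckGroups

/-! ### Finitely presented functors -/

section FinitelyPresented

variable (A : Type u) [Category.{v} A] [Preadditive A]

/-- An additive functor `M : Aᵒᵖ ⥤ Ab` is finitely presented if there is an exact sequence
`A(-, P₁) ⟶ A(-, P₀) ⟶ M ⟶ 0` of functors. -/
def finitelyPresented : ObjectProperty (Aᵒᵖ ⥤ AddCommGrpCat.{v}) := fun M =>
  M.Additive ∧
    ∃ (P₁ P₀ : A) (f : preadditiveYoneda.obj P₁ ⟶ preadditiveYoneda.obj P₀)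
      (g : preadditiveYoneda.obj P₀ ⟶ M) (w : f ≫ g = 0),
      (ShortComplex.mk f g w).Exact ∧ Epi g

/-- The category `mod A` of finitely presented additive functors `Aᵒᵖ ⥤ Ab`. -/
abbrev ModCat : Type _ := (finitelyPresented A).FullSubcategory

end FinitelyPresented

variable {C : Type u} [Category.{v} C]

/-- `P` defines an additive subcategory: a full subcategory closed under isomorphisms,
finite direct sums and direct summands. -/
structure IsAdditiveSubcategory [Preadditive C] [HasZeroObject C] [HasBinaryBiproducts C]
    (P : ObjectProperty C) : Prop where
  of_iso : ∀ {A B : C}, (A ≅ B) → P A → P B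
  zero : ∀ {A : C}, IsZero A → P A
  biprod : ∀ {A B : C}, P A → P B → P (A ⊞ B)
  summand : ∀ {A B : C}, P (A ⊞ B) → P A

/-- `ξ : X ⟶ A` is a right `P`-approximation of `A`. -/
def IsRightApproximation (P : ObjectProperty C) {X A : C} (ξ : X ⟶ A) : Prop :=
  P X ∧ ∀ (X' : C), P X' → ∀ f : X' ⟶ A, ∃ g : X' ⟶ X, g ≫ ξ = f

/-- `P` is contravariantly finite: every object admits a right `P`-approximation. -/
def IsContravariantlyFinite (P : ObjectProperty C) : Prop :=
  ∀ A : C, ∃ (X : C) (ξ : X ⟶ A), IsRightApproximation P ξ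

section Preadditive

variable [Preadditive C]

/-- `P` is rigid: `C(P, ΣP) = 0`. -/
def IsRigid [HasShift C ℤ] (P : ObjectProperty C) : Prop :=
  ∀ (A B : C), P A → P B → ∀ f : A ⟶ B⟦(1 : ℤ)⟧, f = 0

/-- The restricted Yoneda functor `A ↦ C(-, A)|_P`, with values in all functors. -/
def restrictedYoneda (P : ObjectProperty C) :
    C ⥤ (P.FullSubcategoryᵒᵖ ⥤ AddCommGrpCat.{v}) :=
  preadditiveYoneda ⋙ (Functor.whiskeringLeft _ _ _).obj P.ι.op

/-- The natural transformation `P(-, X) ⟶ C(-, A)|_P` given by a morphism `X ⟶ A`. -/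
def yonedaToRestricted (P : ObjectProperty C) (X : P.FullSubcategory) {A : C} (ξ : X.obj ⟶ A) :
    preadditiveYoneda.obj X ⟶ (restrictedYoneda P).obj A where
  app Y := AddCommGrpCat.ofHom
    { toFun := fun (g : Y.unop ⟶ X) => (g.hom ≫ ξ : Y.unop.obj ⟶ A)
      map_zero' := zero_comp
      map_add' := fun _ _ => Preadditive.add_comp _ _ _ _ _ _ }
  naturality _ _ _ := AddCommGrpCat.ext fun _ => Category.assoc _ _ _

end Preadditive

variable [Preadditive C] [HasZeroObject C] [HasShift C ℤ]
  [∀ n : ℤ, (shiftFunctor C n).Additive] [Pretriangulated C]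

lemma restrictedYoneda_finitelyPresented {P : ObjectProperty C}
    (hP : IsContravariantlyFinite P) (A : C) :
    finitelyPresented P.FullSubcategory ((restrictedYoneda P).obj A) := by
  refine ⟨⟨fun {X Y f g} => AddCommGrpCat.ext fun x =>
    Preadditive.add_comp _ _ _ f.unop.hom g.unop.hom x⟩, ?_⟩
  obtain ⟨X₀, ξ, h₀, hξ⟩ := hP A
  obtain ⟨K, i, δ, hT⟩ := distinguished_cocone_triangle₁ ξ
  obtain ⟨X₁, η, h₁, hη⟩ := hP K
  have hiξ : i ≫ ξ = 0 := comp_distTriang_mor_zero₁₂ _ hT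
  refine ⟨⟨X₁, h₁⟩, ⟨X₀, h₀⟩, preadditiveYoneda.map (ObjectProperty.homMk (η ≫ i)),
    yonedaToRestricted P ⟨X₀, h₀⟩ ξ, ?_, ?_, ?_⟩
  · ext Y g
    change (g.hom ≫ η ≫ i) ≫ ξ = 0
    simp [hiξ]
  · rw [ShortComplex.exact_iff_isZero_homology, Functor.isZero_iff]
    intro Y
    refine IsZero.of_iso ?_
      (ShortComplex.mapHomologyIso _ ((evaluation _ AddCommGrpCat.{v}).obj Y)).symm
    rw [← ShortComplex.exact_iff_isZero_homology, ShortComplex.ab_exact_iff]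
    intro g hg
    have hg' : InducedCategory.Hom.hom (g : Y.unop ⟶ (⟨X₀, h₀⟩ : P.FullSubcategory)) ≫ ξ = 0 :=
      hg
    obtain ⟨l, hl⟩ := Triangle.coyoneda_exact₂ _ hT _ hg'
    obtain ⟨m, hm⟩ := hη Y.unop.obj Y.unop.property l
    refine ⟨ObjectProperty.homMk m, ?_⟩
    apply InducedCategory.hom_ext
    change m ≫ η ≫ i = _
    rw [← Category.assoc, hm]
    exact hl.symm
  · rw [NatTrans.epi_iff_epi_app]
    intro Y
    rw [AddCommGrpCat.epi_iff_surjective]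
    intro f
    obtain ⟨g, hg⟩ := hξ Y.unop.obj Y.unop.property f
    exact ⟨ObjectProperty.homMk g, hg⟩

/-- The functor `H_P : C ⥤ mod P`, `A ↦ C(-, A)|_P`. -/
def H {P : ObjectProperty C} (hP : IsContravariantlyFinite P) :
    C ⥤ ModCat P.FullSubcategory :=
  ObjectProperty.lift _ (restrictedYoneda P) (restrictedYoneda_finitelyPresented hP)

/-- The restriction `L|_X` of a functor `L` in `mod T` along an inclusion `X ⊆ T`. -/
def restrict {X T : ObjectProperty C} (hXT : X ≤ T) (L : ModCat T.FullSubcategory) :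
    X.FullSubcategoryᵒᵖ ⥤ AddCommGrpCat.{v} :=
  (ObjectProperty.ιOfLE hXT).op ⋙ L.obj

/-! ### The relative extriangulated structure and its Grothendieck group -/

/-- The relative extension group `E_D(B, A)`: the subgroup of `E(B, A) = C(B, ΣA)` of those `δ`
with `C(-, δ)|_D = 0`, i.e. all composites `X ⟶ B ⟶ ΣA` with `X` in `D` vanish. -/
def relExt (D : ObjectProperty C) (B A : C) : AddSubgroup (B ⟶ A⟦(1 : ℤ)⟧) where
  carrier := {δ | ∀ (X : C), D X → ∀ ξ : X ⟶ B, ξ ≫ δ = 0}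
  zero_mem' := fun _ _ _ => comp_zero
  add_mem' := fun ha hb X hX ξ => by
    rw [Preadditive.comp_add, ha X hX ξ, hb X hX ξ, add_zero]
  neg_mem' := fun ha X hX ξ => by
    rw [Preadditive.comp_neg, ha X hX ξ, neg_zero]

lemma mem_relExt_iff (D : ObjectProperty C) {B A : C} (δ : B ⟶ A⟦(1 : ℤ)⟧) :
    δ ∈ relExt D B A ↔ (restrictedYoneda D).map δ = 0 := by
  constructor
  · intro h
    ext X ξ
    exact h X.unop.obj X.unop.property ξ
  · intro h X hX ξ
    exact congrArg (fun φ => (φ.app (Opposite.op ⟨X, hX⟩)).hom ξ) h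

/-- `E_D` is a subbifunctor of `E`. -/
lemma relExt_comp (D : ObjectProperty C) {B B' A A' : C} (β : B' ⟶ B) (α : A ⟶ A')
    {δ : B ⟶ A⟦(1 : ℤ)⟧} (h : δ ∈ relExt D B A) : β ≫ δ ≫ α⟦(1 : ℤ)⟧' ∈ relExt D B' A' := by
  intro X hX ξ
  have := h X hX (ξ ≫ β)
  rw [← Category.assoc, ← Category.assoc, this, zero_comp]

/-- The realisation `s_D`: the complex `S` represents `s_D(δ)`, for `δ` in `E_D(S.X₃, S.X₁)`.
Here `s_D` is the restriction to `E_D` of the realisation of `E` by distinguished triangles. -/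
def IsRealisation (D : ObjectProperty C) (S : ShortComplex C)
    (δ : relExt D S.X₃ S.X₁) : Prop :=
  Triangle.mk S.f S.g (δ : S.X₃ ⟶ S.X₁⟦(1 : ℤ)⟧) ∈ distTriang C

/-- `S` is an `s_D`-conflation of the relative extriangulated category `(C, E_D, s_D)`. -/
def IsConflation (D : ObjectProperty C) (S : ShortComplex C) : Prop :=
  ∃ δ : relExt D S.X₃ S.X₁, IsRealisation D S δ

/-- The subgroup `I_D` of the split Grothendieck group of `C` generated by the elements
`[A] - [B] + [B']`, one for each `s_D`-conflation `A ⟶ B ⟶ B'`. -/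
def conflationRelations (D : ObjectProperty C) : AddSubgroup (SplitK0 C) :=
  AddSubgroup.closure {x | ∃ S : ShortComplex C, IsConflation D S ∧
    x = splitClass S.X₁ - splitClass S.X₂ + splitClass S.X₃}

/-- The Grothendieck group `K₀(C, E_D, s_D)`. -/
abbrev RelK0 (D : ObjectProperty C) : Type u := SplitK0 C ⧸ conflationRelations D

/-- The index of an object with respect to `D`: its class in `K₀(C, E_D, s_D)`. -/
def index (D : ObjectProperty C) (A : C) : RelK0 D :=
  QuotientAddGroup.mk' (conflationRelations D) (splitClass A)

lemma isConflation_of_le {X T : ObjectProperty C} (hXT : X ≤ T) {S : ShortComplex C}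
    (h : IsConflation T S) : IsConflation X S := by
  obtain ⟨δ, hδ⟩ := h
  exact ⟨⟨δ.1, fun Y hY ξ => δ.2 Y (hXT Y hY) ξ⟩, hδ⟩

lemma conflationRelations_le {X T : ObjectProperty C} (hXT : X ≤ T) :
    conflationRelations T ≤ conflationRelations X :=
  AddSubgroup.closure_mono fun _ ⟨S, hS, hx⟩ => ⟨S, isConflation_of_le hXT hS, hx⟩

/-- The canonical homomorphism `Q : K₀(C, E_T, s_T) ⟶ K₀(C, E_X, s_X)` for `X ⊆ T`, induced by
the identity of the split Grothendieck group. -/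
def Q {X T : ObjectProperty C} (hXT : X ≤ T) : RelK0 T →+ RelK0 X :=
  QuotientAddGroup.map (conflationRelations T) (conflationRelations X) (AddMonoidHom.id _)
    (conflationRelations_le hXT)

lemma Q_index {X T : ObjectProperty C} (hXT : X ≤ T) (A : C) :
    Q hXT (index T A) = index X A := rfl

lemma Q_surjective {X T : ObjectProperty C} (hXT : X ≤ T) : Function.Surjective (Q hXT) := by
  intro x
  obtain ⟨y, rfl⟩ := QuotientAddGroup.mk_surjective x
  exact ⟨QuotientAddGroup.mk y, rfl⟩

/-- `θ` is the homomorphism `θ_T : K₀(mod T) ⟶ K₀(C, E_T, s_T)`: it sends the class of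
`H_T(A)` to `[A] + [Σ⁻¹A]`, for every object `A` of `C`. -/
def IsTheta {T : ObjectProperty C} (hT : IsContravariantlyFinite T)
    (θ : AbK0 (ModCat T.FullSubcategory) →+ RelK0 T) : Prop :=
  ∀ A : C, θ (abClass ((H hT).obj A)) = index T A + index T (A⟦(-1 : ℤ)⟧)

end

end RelIndex

open RelIndex

/-! To `f : A ⟶ B` with cone `Z` attach `defect f` = [A] + [Σ⁻¹B] - [Σ⁻¹Z]. It should be read as θ
of the image of `H f`: by the octahedral axiom it is unchanged under precomposition with a map
surjective on `T` (`defect_comp_of_isRelEpi`) and postcomposition with a map injective on `T`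
(`defect_comp_of_isRelMono`), and on `𝟙 A` it is [A] + [Σ⁻¹A].

Existence of θ: by rigidity every module is `H E` with `E` a cone of a map in `T`, and maps out of
such `H E` lift to `C`. Computing the defect of a lifted isomorphism in two ways shows that [E] +
[Σ⁻¹E] depends only on the module. Additivity comes from `defect_add_defect`, the shadow of 0 → im f
→ H B → im g → 0 for consecutive maps of a triangle.

Kernel of `Q`: a triangle A → B → C with connecting map δ has [A] - [B] + [C] = `defect δ`, which is
θ of the image of `H δ`; if δ vanishes on `X`, so does this image. Conversely, if `H A` vanishes on
`X`, then Σ⁻¹A → 0 → A is an `X`-conflation, so [A] + [Σ⁻¹A] dies. -/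

namespace RelIndex

variable {C : Type u} [Category.{v} C]

/-! ### Maps that are zero, surjective or injective on a subcategory -/

section Ghost

variable [Preadditive C]

/-- `f` is a `D`-ghost: `C(-, f)|_D = 0`. -/
def IsGhost (D : ObjectProperty C) {A B : C} (f : A ⟶ B) : Prop :=
  ∀ Y : C, D Y → ∀ ξ : Y ⟶ A, ξ ≫ f = 0

/-- `C(-, f)|_D` is surjective. -/
def IsRelEpi (D : ObjectProperty C) {A B : C} (f : A ⟶ B) : Prop :=
  ∀ Y : C, D Y → ∀ ξ : Y ⟶ B, ∃ η : Y ⟶ A, η ≫ f = ξ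

/-- `C(-, f)|_D` is injective. -/
def IsRelMono (D : ObjectProperty C) {A B : C} (f : A ⟶ B) : Prop :=
  ∀ Y : C, D Y → ∀ ξ : Y ⟶ A, ξ ≫ f = 0 → ξ = 0

variable {D : ObjectProperty C} {A B E : C}

lemma IsGhost.comp_right {f : A ⟶ B} (hf : IsGhost D f) (g : B ⟶ E) : IsGhost D (f ≫ g) :=
  fun Y hY ξ => by rw [← Category.assoc, hf Y hY, zero_comp]

lemma IsGhost.comp_left {g : B ⟶ E} (hg : IsGhost D g) (f : A ⟶ B) : IsGhost D (f ≫ g) :=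
  fun Y hY ξ => by rw [← Category.assoc, hg Y hY]

lemma IsGhost.of_comp_isRelMono {f : A ⟶ B} {g : B ⟶ E} (hg : IsRelMono D g)
    (h : IsGhost D (f ≫ g)) : IsGhost D f :=
  fun Y hY ξ => hg Y hY _ (by rw [Category.assoc, h Y hY])

lemma isRelMono_of_isIso (f : A ⟶ B) [IsIso f] : IsRelMono D f :=
  fun _ _ ξ h => by rwa [← cancel_mono f, zero_comp]

lemma IsRightApproximation.isRelEpi {f : A ⟶ B} (hf : IsRightApproximation D f) :
    IsRelEpi D f := hf.2

end Ghost

variable [Preadditive C] [HasZeroObject C] [HasShift C ℤ]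
  [∀ n : ℤ, (shiftFunctor C n).Additive] [Pretriangulated C]

/-! ### Index relations from triangles containing a ghost -/

section Index

variable {D : ObjectProperty C} {A B Z : C} {f : A ⟶ B} {g : B ⟶ Z} {h : Z ⟶ A⟦(1 : ℤ)⟧}

lemma index_eq_of_iso {A B : C} (e : A ≅ B) : index D A = index D B := by
  have : freeClass A = freeClass B := congrArg FreeAbelianGroup.of (Quotient.sound ⟨e⟩)
  simp only [index, splitClass, this]

lemma isGhost_shift_neg_shift {A B : C} {f : A ⟶ B} (hf : IsGhost D f) :
    IsGhost D (f⟦(1 : ℤ)⟧'⟦(-1 : ℤ)⟧') := by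
  rw [show f⟦(1 : ℤ)⟧'⟦(-1 : ℤ)⟧' = (shiftShiftNeg A (1 : ℤ)).hom ≫ f ≫
    (shiftShiftNeg B (1 : ℤ)).inv from shift_shift_neg' f 1]
  exact (hf.comp_right _).comp_left _

lemma index_triangle (hS : Triangle.mk f g h ∈ distTriang C) (hh : IsGhost D h) :
    index D A - index D B + index D Z = 0 := by
  have hm : splitClass A - splitClass B + splitClass Z ∈ conflationRelations D :=
    AddSubgroup.subset_closure ⟨ShortComplex.mk f g (comp_distTriang_mor_zero₁₂ _ hS),
      ⟨⟨h, hh⟩, hS⟩, rfl⟩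
  exact (QuotientAddGroup.eq_zero_iff _).2 hm

lemma invRotate_mk_distinguished (hS : Triangle.mk f g h ∈ distTriang C) :
    Triangle.mk (-h⟦(-1 : ℤ)⟧' ≫ (shiftShiftNeg A (1 : ℤ)).hom) f
      (g ≫ (shiftNegShift Z (1 : ℤ)).inv) ∈ distTriang C :=
  inv_rot_of_distTriang _ hS

/-- Rotating backwards turns `g`, up to isomorphism, into the connecting map. -/
lemma index_triangle_of_isGhost₂ (hS : Triangle.mk f g h ∈ distTriang C) (hg : IsGhost D g) :
    index D (Z⟦(-1 : ℤ)⟧) - index D A + index D B = 0 :=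
  index_triangle (invRotate_mk_distinguished hS) (hg.comp_right _)

lemma index_triangle_of_isGhost₁ (hS : Triangle.mk f g h ∈ distTriang C) (hf : IsGhost D f) :
    index D (B⟦(-1 : ℤ)⟧) - index D (Z⟦(-1 : ℤ)⟧) + index D A = 0 :=
  index_triangle_of_isGhost₂ (invRotate_mk_distinguished hS) hf

lemma index_triangle_of_isGhost_shift (hS : Triangle.mk f g h ∈ distTriang C)
    (hh : IsGhost D (h⟦(-1 : ℤ)⟧')) :
    index D (A⟦(-1 : ℤ)⟧) - index D (B⟦(-1 : ℤ)⟧) + index D (Z⟦(-1 : ℤ)⟧) = 0 := by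
  refine index_triangle_of_isGhost₁ (invRotate_mk_distinguished hS) fun Y hY ξ => ?_
  rw [Preadditive.comp_neg, hh.comp_right _ Y hY, neg_zero]

lemma index_of_isZero {A : C} (hA : IsZero A) : index D A = 0 := by
  have := index_triangle (D := D) (contractible_distinguished A)
    (fun _ _ _ => comp_zero)
  rw [index_eq_of_iso ((isZero_zero C).iso hA), sub_self, zero_add] at this
  exact this

lemma IsRelEpi.isGhost (hS : Triangle.mk f g h ∈ distTriang C) (hf : IsRelEpi D f) :
    IsGhost D g := fun Y hY ξ => by
  obtain ⟨η, rfl⟩ := hf Y hY ξ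
  have : f ≫ g = 0 := comp_distTriang_mor_zero₁₂ _ hS
  rw [Category.assoc, this, comp_zero]

lemma isRelEpi_of_isGhost (hS : Triangle.mk f g h ∈ distTriang C) (hg : IsGhost D g) :
    IsRelEpi D f := fun Y hY ξ => by
  obtain ⟨l, hl⟩ := Triangle.coyoneda_exact₂ _ hS ξ (hg Y hY ξ)
  exact ⟨l, hl.symm⟩

lemma isRelEpi_of_isGhost₃ (hS : Triangle.mk f g h ∈ distTriang C) (hh : IsGhost D h) :
    IsRelEpi D g := fun Y hY ξ => by
  obtain ⟨l, hl⟩ := Triangle.coyoneda_exact₃ _ hS ξ (hh Y hY ξ)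
  exact ⟨l, hl.symm⟩

lemma isRelMono_of_isGhost (hS : Triangle.mk f g h ∈ distTriang C) (hf : IsGhost D f) :
    IsRelMono D g := fun Y hY ξ hξ => by
  obtain ⟨l, hl⟩ := Triangle.coyoneda_exact₂ _ hS ξ hξ
  rw [hl]
  exact hf Y hY l

/-- Up to isomorphism and sign, Σ⁻¹h is the map preceding `f` in the triangle; its composite with
`f` is zero, and `f` can be cancelled on `D`. -/
lemma IsRelMono.isGhost (hS : Triangle.mk f g h ∈ distTriang C) (hf : IsRelMono D f) :
    IsGhost D (h⟦(-1 : ℤ)⟧') := by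
  have : IsGhost D ((h⟦(-1 : ℤ)⟧' ≫ (shiftShiftNeg A (1 : ℤ)).hom) ≫ f) := by
    intro Y hY ξ
    have h₁ : f⟦(1 : ℤ)⟧'⟦(-1 : ℤ)⟧' ≫ (shiftShiftNeg B (1 : ℤ)).hom =
        (shiftShiftNeg A (1 : ℤ)).hom ≫ f :=
      (shiftFunctorCompIsoId C (1 : ℤ) (-1) (add_neg_cancel 1)).hom.naturality f
    have h₂ : h ≫ f⟦(1 : ℤ)⟧' = 0 := comp_distTriang_mor_zero₃₁ _ hS
    rw [Category.assoc, ← h₁, ← Functor.map_comp_assoc, h₂,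
      Functor.map_zero, zero_comp, comp_zero]
  exact (this.of_comp_isRelMono hf).of_comp_isRelMono (isRelMono_of_isIso _)

end Index

/-! ### The defect of a morphism -/

section Defect

variable (D : ObjectProperty C)

/-- The alternating sum `[A] + [Σ⁻¹B] - [Σ⁻¹Z]` attached to `f : A ⟶ B` with cone `Z`. -/
noncomputable def defect {A B : C} (f : A ⟶ B) : RelK0 D :=
  index D A + index D (B⟦(-1 : ℤ)⟧) -
    index D ((distinguished_cocone_triangle f).choose⟦(-1 : ℤ)⟧)

variable {D}

lemma defect_eq {A B Z : C} {f : A ⟶ B} {g : B ⟶ Z} {h : Z ⟶ A⟦(1 : ℤ)⟧}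
    (hS : Triangle.mk f g h ∈ distTriang C) :
    defect D f = index D A + index D (B⟦(-1 : ℤ)⟧) - index D (Z⟦(-1 : ℤ)⟧) := by
  obtain ⟨g', h', hS'⟩ := (distinguished_cocone_triangle f).choose_spec
  have e : Z ≅ (distinguished_cocone_triangle f).choose :=
    Triangle.π₃.mapIso (isoTriangleOfIso₁₂ _ _ hS hS' (Iso.refl _) (Iso.refl _)
      ((Category.comp_id _).trans (Category.id_comp _).symm))
  rw [defect, index_eq_of_iso ((shiftFunctor C (-1 : ℤ)).mapIso e)]

lemma defect_id (A : C) : defect D (𝟙 A) = index D A + index D (A⟦(-1 : ℤ)⟧) := by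
  rw [defect_eq (contractible_distinguished A),
    index_of_isZero (Functor.map_isZero _ (isZero_zero C)), sub_zero]

variable [IsTriangulated C]

lemma defect_comp_of_isRelEpi {A B E : C} {f : A ⟶ B} (hf : IsRelEpi D f) (g : B ⟶ E) :
    defect D (f ≫ g) = defect D g := by
  obtain ⟨Z₁, v₁, w₁, h₁⟩ := distinguished_cocone_triangle f
  obtain ⟨Z₂, v₂, w₂, h₂⟩ := distinguished_cocone_triangle g
  obtain ⟨Z₃, v₃, w₃, h₃⟩ := distinguished_cocone_triangle (f ≫ g)
  have o := Triangulated.someOctahedron rfl h₁ h₂ h₃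
  have hv : IsGhost D v₁ := hf.isGhost h₁
  have e₁ := index_triangle_of_isGhost₂ h₁ hv
  -- The octahedron's connecting map is `w₂` followed by Σv₁, and `v₁` is a ghost.
  have e₂ := index_triangle_of_isGhost_shift (D := D) o.mem (by
    rw [Functor.map_comp]
    exact (isGhost_shift_neg_shift hv).comp_left _)
  rw [defect_eq h₃, defect_eq h₂, ← sub_eq_zero, ← sub_eq_zero.2 (e₂.trans e₁.symm)]
  abel

lemma defect_comp_of_isRelMono {A B E : C} (f : A ⟶ B) {g : B ⟶ E} (hg : IsRelMono D g) :
    defect D (f ≫ g) = defect D f := by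
  obtain ⟨Z₁, v₁, w₁, h₁⟩ := distinguished_cocone_triangle f
  obtain ⟨Z₂, v₂, w₂, h₂⟩ := distinguished_cocone_triangle g
  obtain ⟨Z₃, v₃, w₃, h₃⟩ := distinguished_cocone_triangle (f ≫ g)
  have o := Triangulated.someOctahedron rfl h₁ h₂ h₃
  have hw : IsGhost D (w₂⟦(-1 : ℤ)⟧') := hg.isGhost h₂
  have e₁ := index_triangle_of_isGhost_shift h₂ hw
  -- The same connecting map; now its first factor `w₂` becomes a ghost after Σ⁻¹.
  have e₂ := index_triangle_of_isGhost_shift (D := D) o.mem (by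
    rw [Functor.map_comp]
    exact hw.comp_right _)
  rw [defect_eq h₃, defect_eq h₁, ← sub_eq_zero, ← sub_eq_zero.2 (e₂.trans e₁.symm)]
  abel

lemma defect_of_isRelEpi {A B : C} {f : A ⟶ B} (hf : IsRelEpi D f) :
    defect D f = index D B + index D (B⟦(-1 : ℤ)⟧) := by
  rw [← defect_id, ← defect_comp_of_isRelEpi hf, Category.comp_id]

lemma defect_of_isRelMono {A B : C} {f : A ⟶ B} (hf : IsRelMono D f) :
    defect D f = index D A + index D (A⟦(-1 : ℤ)⟧) := by
  rw [← defect_id, ← defect_comp_of_isRelMono _ hf, Category.id_comp]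

lemma defect_add_defect {A B Z : C} {f : A ⟶ B} {g : B ⟶ Z} {h : Z ⟶ A⟦(1 : ℤ)⟧}
    (hS : Triangle.mk f g h ∈ distTriang C) :
    defect D f + defect D g = index D B + index D (B⟦(-1 : ℤ)⟧) := by
  have hR : Triangle.mk g h (-f⟦(1 : ℤ)⟧') ∈ distTriang C := rot_of_distTriang _ hS
  rw [defect_eq hS, defect_eq hR, index_eq_of_iso (shiftShiftNeg A (1 : ℤ))]
  abel

/-- Every morphism `f` factors, up to a precomposition with a relative epimorphism, as a
relative epimorphism followed by a relative monomorphism. -/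
lemma exists_image_factorisation (hfin : IsContravariantlyFinite D) (hD : IsRigid D)
    {A B : C} (f : A ⟶ B) : ∃ (P E : C) (p : P ⟶ A) (q : P ⟶ E) (m : E ⟶ B),
      IsRelEpi D p ∧ IsRelEpi D q ∧ IsRelMono D m ∧ p ≫ f = q ≫ m := by
  obtain ⟨P, p, hp⟩ := hfin A
  obtain ⟨K, i, w, hK⟩ := distinguished_cocone_triangle₁ (p ≫ f)
  obtain ⟨R, r, hr⟩ := hfin K
  obtain ⟨E, q, t, hE⟩ := distinguished_cocone_triangle (r ≫ i)
  obtain ⟨m, hm⟩ : ∃ m : E ⟶ B, p ≫ f = q ≫ m := Triangle.yoneda_exact₂ _ hE (p ≫ f) (by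
    have : i ≫ p ≫ f = 0 := comp_distTriang_mor_zero₁₂ _ hK
    change (r ≫ i) ≫ p ≫ f = 0
    rw [Category.assoc, this, comp_zero])
  -- Since `R` lies in `D`, rigidity makes the connecting map `E ⟶ ΣR` a ghost.
  have hq : IsRelEpi D q :=
    isRelEpi_of_isGhost₃ hE (fun Y hY ξ => hD Y R hY hr.1 (ξ ≫ t))
  refine ⟨P, E, p, q, m, hp.isRelEpi, hq, fun Y hY ξ hξ => ?_, hm⟩
  obtain ⟨η, rfl⟩ := hq Y hY ξ
  -- A lift to `P` killed by `p ≫ f` comes from `K`, hence from `R`, and so dies in `E`.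
  obtain ⟨ζ, rfl⟩ := Triangle.coyoneda_exact₂ _ hK η (by
    change η ≫ p ≫ f = 0
    rw [hm]
    exact (Category.assoc _ _ _).symm.trans hξ)
  obtain ⟨σ, rfl⟩ := hr.2 Y hY ζ
  have : (r ≫ i) ≫ q = 0 := comp_distTriang_mor_zero₁₂ _ hE
  change ((σ ≫ r) ≫ i) ≫ q = 0
  simp only [Category.assoc] at this ⊢
  rw [this, comp_zero]

end Defect

/-! ### Finitely presented functors and the homomorphism θ -/

section FinitelyPresentedFunctors

open Opposite

variable {C : Type u} [Category.{v} C] [Preadditive C] [HasZeroObject C] [HasShift C ℤ]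
  [∀ n : ℤ, (shiftFunctor C n).Additive] [Pretriangulated C]
  {D : ObjectProperty C} (hfin : IsContravariantlyFinite D)

variable {hfin} in
/-- The value of a morphism `H A ⟶ H B` at an element `ξ : Y ⟶ A` of `H A`. -/
def act {A B : C} (φ : (H hfin).obj A ⟶ (H hfin).obj B) {Y : C} (hY : D Y) (ξ : Y ⟶ A) :
    Y ⟶ B :=
  (φ.hom.app (op ⟨Y, hY⟩)).hom ξ

section Act

variable {hfin} {A B E : C} (φ : (H hfin).obj A ⟶ (H hfin).obj B)

lemma act_comp {Y Y' : C} (hY : D Y) (hY' : D Y') (η : Y' ⟶ Y) (ξ : Y ⟶ A) :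
    act φ hY' (η ≫ ξ) = η ≫ act φ hY ξ :=
  congrArg (fun ψ => ψ.hom ξ)
    (φ.hom.naturality (Quiver.Hom.op (ObjectProperty.homMk η : (⟨Y', hY'⟩ :
      D.FullSubcategory) ⟶ ⟨Y, hY⟩)))

lemma act_zero {Y : C} (hY : D Y) : act φ hY 0 = 0 :=
  map_zero (φ.hom.app (op ⟨Y, hY⟩)).hom

lemma act_map (f : A ⟶ B) {Y : C} (hY : D Y) (ξ : Y ⟶ A) :
    act ((H hfin).map f) hY ξ = ξ ≫ f := rfl

lemma hom_ext_act {φ ψ : (H hfin).obj A ⟶ (H hfin).obj B}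
    (h : ∀ (Y : C) (hY : D Y) (ξ : Y ⟶ A), act φ hY ξ = act ψ hY ξ) : φ = ψ := by
  apply InducedCategory.hom_ext
  ext Y ξ
  exact h Y.unop.obj Y.unop.property ξ

lemma H_map_eq_zero_iff {f : A ⟶ B} : (H hfin).map f = 0 ↔ IsGhost D f :=
  ⟨fun h Y hY ξ => congrArg (fun φ => act φ hY ξ) h, fun h => hom_ext_act h⟩

lemma exists_map_eq_of_mem (hA : D A) : ∃ f : A ⟶ B, (H hfin).map f = φ :=
  ⟨act φ hA (𝟙 A), hom_ext_act fun _ hY ξ => by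
    rw [act_map, ← act_comp, Category.comp_id]⟩

lemma eq_of_H_map_eq (hA : D A) {f g : A ⟶ B} (h : (H hfin).map f = (H hfin).map g) :
    f = g := by
  have := congrArg (fun φ => act φ hA (𝟙 A)) h
  simpa [act_map] using this

end Act

section Presentation

/-- `E` is the cone of a morphism between objects of `D`. -/
def IsPresented (D : ObjectProperty C) (E : C) : Prop :=
  ∃ (R P : C) (r : R ⟶ P) (q : P ⟶ E) (t : E ⟶ R⟦(1 : ℤ)⟧),
    D R ∧ D P ∧ Triangle.mk r q t ∈ distTriang C

variable {hfin}

/-- A Yoneda argument on `P`: the image of `q` under `φ` is killed by `r`, so it extends over the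
cone `E`. This determines `φ` because, by rigidity, every map from `D` to `E` factors through `q`.
-/
lemma exists_map_eq (hD : IsRigid D) {E B : C} (hE : IsPresented D E)
    (φ : (H hfin).obj E ⟶ (H hfin).obj B) : ∃ f : E ⟶ B, (H hfin).map f = φ := by
  obtain ⟨R, P, r, q, t, hR, hP, hT⟩ := hE
  have w : r ≫ q = 0 := comp_distTriang_mor_zero₁₂ _ hT
  obtain ⟨f, hf⟩ : ∃ f : E ⟶ B, act φ hP q = q ≫ f :=
    Triangle.yoneda_exact₂ _ hT (act φ hP q) (by
      change r ≫ act φ hP q = 0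
      rw [← act_comp φ hP hR, w, act_zero])
  refine ⟨f, hom_ext_act fun Y hY ξ => ?_⟩
  obtain ⟨η, rfl⟩ := isRelEpi_of_isGhost₃ hT (fun Y hY ξ => hD Y R hY hR (ξ ≫ t)) Y hY ξ
  rw [act_map, act_comp φ hP hY, hf, Category.assoc]

lemma isRelMono_of_mono {A B : C} (f : A ⟶ B) [Mono ((H hfin).map f)] : IsRelMono D f := by
  obtain ⟨K, k, t, hT⟩ := distinguished_cocone_triangle₁ f
  have w : k ≫ f = 0 := comp_distTriang_mor_zero₁₂ _ hT
  refine isRelMono_of_isGhost hT (H_map_eq_zero_iff (hfin := hfin).1 ?_)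
  rw [← cancel_mono ((H hfin).map f), ← Functor.map_comp, w, zero_comp]
  exact H_map_eq_zero_iff.2 fun _ _ _ => comp_zero

lemma isRelEpi_of_epi {A B : C} (f : A ⟶ B) [Epi ((H hfin).map f)] : IsRelEpi D f := by
  obtain ⟨Z, g, t, hT⟩ := distinguished_cocone_triangle f
  have w : f ≫ g = 0 := comp_distTriang_mor_zero₁₂ _ hT
  refine isRelEpi_of_isGhost hT (H_map_eq_zero_iff (hfin := hfin).1 ?_)
  rw [← cancel_epi ((H hfin).map f), ← Functor.map_comp, w, comp_zero]
  exact H_map_eq_zero_iff.2 fun _ _ _ => comp_zero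

lemma isIso_H_map {A B : C} {f : A ⟶ B} (hm : IsRelMono D f) (he : IsRelEpi D f) :
    IsIso ((H hfin).map f) := by
  have : ∀ Y, IsIso (((H hfin).map f).hom.app Y) := fun Y => by
    rw [ConcreteCategory.isIso_iff_bijective]
    refine ⟨(injective_iff_map_eq_zero (((H hfin).map f).hom.app Y).hom).2 fun ξ hξ => ?_,
      fun ξ => he _ Y.unop.property ξ⟩
    exact hm _ Y.unop.property ξ hξ
  have : IsIso ((finitelyPresented D.FullSubcategory).ι.map ((H hfin).map f)) :=
    NatIso.isIso_of_isIso_app ((H hfin).map f).hom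
  exact isIso_of_reflects_iso _ (finitelyPresented D.FullSubcategory).ι

variable (hfin) in
-- A presentation of `M` comes from a map `r` in `D`. By rigidity the cone `E` of `r` gives a second
-- cokernel of the same map of representables.
lemma exists_isPresented_iso (hD : IsRigid D) (M : ModCat D.FullSubcategory) :
    ∃ E : C, IsPresented D E ∧ Nonempty ((H hfin).obj E ≅ M) := by
  obtain ⟨M, -, P₁, P₀, f, g, w, hex, hg⟩ := M
  obtain ⟨r, rfl⟩ := preadditiveYoneda.map_surjective f
  obtain ⟨E, q, t, hT⟩ := distinguished_cocone_triangle r.hom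
  have hrq : r.hom ≫ q = 0 := comp_distTriang_mor_zero₁₂ _ hT
  have w' : preadditiveYoneda.map r ≫ yonedaToRestricted D P₀ q = 0 := by
    ext Y ξ
    change (ξ.hom ≫ r.hom) ≫ q = 0
    rw [Category.assoc, hrq, comp_zero]
  have hepi : Epi (yonedaToRestricted D P₀ q) := by
    rw [NatTrans.epi_iff_epi_app]
    intro Y
    rw [AddCommGrpCat.epi_iff_surjective]
    intro ξ
    obtain ⟨η, hη⟩ := isRelEpi_of_isGhost₃ hT
      (fun Y hY ξ => hD Y P₁.obj hY P₁.property (ξ ≫ t)) Y.unop.obj Y.unop.property ξ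
    exact ⟨ObjectProperty.homMk η, hη⟩
  have hex' : (ShortComplex.mk _ _ w').Exact := by
    rw [ShortComplex.exact_iff_isZero_homology, Functor.isZero_iff]
    intro Y
    refine IsZero.of_iso ?_
      (ShortComplex.mapHomologyIso _ ((evaluation _ AddCommGrpCat.{v}).obj Y)).symm
    rw [← ShortComplex.exact_iff_isZero_homology, ShortComplex.ab_exact_iff]
    intro ξ hξ
    have hξ' : InducedCategory.Hom.hom (ξ : Y.unop ⟶ P₀) ≫ q = 0 := hξ
    obtain ⟨l, hl⟩ : ∃ l : Y.unop.obj ⟶ P₁.obj,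
        InducedCategory.Hom.hom (ξ : Y.unop ⟶ P₀) = l ≫ r.hom :=
      Triangle.coyoneda_exact₂ _ hT _ hξ'
    exact ⟨ObjectProperty.homMk l, InducedCategory.hom_ext hl.symm⟩
  refine ⟨E, ⟨_, _, _, _, _, P₁.property, P₀.property, hT⟩, ⟨ObjectProperty.isoMk _ ?_⟩⟩
  exact hex'.gIsCokernel.coconePointUniqueUpToIso hex.gIsCokernel

/-- This is what makes the monomorphism of a short exact sequence a kernel, with no abelian
structure needed. After lifting to `C`, a mono that is epi is bijective at each object of `D`. -/
lemma balanced_modCat (hfin : IsContravariantlyFinite D) (hD : IsRigid D) :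
    Balanced (ModCat D.FullSubcategory) where
  isIso_of_mono_of_epi {M N} φ _ _ := by
    obtain ⟨A, hA, ⟨a⟩⟩ := exists_isPresented_iso hfin hD M
    obtain ⟨B, -, ⟨b⟩⟩ := exists_isPresented_iso hfin hD N
    obtain ⟨f, hf⟩ := exists_map_eq hD hA (a.hom ≫ φ ≫ b.inv)
    have hm : Mono ((H hfin).map f) := hf ▸ inferInstance
    have he : Epi ((H hfin).map f) := hf ▸ inferInstance
    have := isIso_H_map (hfin := hfin) (isRelMono_of_mono (hfin := hfin) f)
      (isRelEpi_of_epi (hfin := hfin) f)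
    rw [show φ = a.inv ≫ (H hfin).map f ≫ b.hom by simp [hf]]
    infer_instance

end Presentation

section Theta

variable [IsTriangulated C]

/-- An isomorphism lifts to a map both injective and surjective on `D`, whose defect has two
expressions. Lifting needs a presented source, so both objects are compared with a presented one. -/
lemma index_add_eq_of_iso (hD : IsRigid D) {A B : C} (e : (H hfin).obj A ≅ (H hfin).obj B) :
    index D A + index D (A⟦(-1 : ℤ)⟧) = index D B + index D (B⟦(-1 : ℤ)⟧) := by
  have key : ∀ {E A : C}, IsPresented D E → ((H hfin).obj E ≅ (H hfin).obj A) →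
      index D E + index D (E⟦(-1 : ℤ)⟧) = index D A + index D (A⟦(-1 : ℤ)⟧) := by
    intro E A hE e
    obtain ⟨f, hf⟩ := exists_map_eq hD hE e.hom
    have : IsIso ((H hfin).map f) := hf ▸ inferInstance
    rw [← defect_of_isRelMono (isRelMono_of_mono (hfin := hfin) f),
      ← defect_of_isRelEpi (isRelEpi_of_epi (hfin := hfin) f)]
  obtain ⟨E, hE, ⟨e'⟩⟩ := exists_isPresented_iso hfin hD ((H hfin).obj A)
  rw [← key hE e', key hE (e' ≪≫ e)]

/-- The value of `θ` at the class of `M`. -/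
noncomputable def thetaObj (hD : IsRigid D) (M : ModCat D.FullSubcategory) : RelK0 D :=
  index D (exists_isPresented_iso hfin hD M).choose +
    index D ((exists_isPresented_iso hfin hD M).choose⟦(-1 : ℤ)⟧)

lemma thetaObj_eq (hD : IsRigid D) {M : ModCat D.FullSubcategory} {A : C}
    (e : (H hfin).obj A ≅ M) :
    thetaObj hfin hD M = index D A + index D (A⟦(-1 : ℤ)⟧) :=
  index_add_eq_of_iso hfin hD
    ((exists_isPresented_iso hfin hD M).choose_spec.2.some ≪≫ e.symm)

/-- With `a : A ⟶ B` the fibre of `g`, the maps `H a` and `H f` have the same image, the kernel of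
`H g`. So `a` and `f` have equal defects, and `defect_add_defect` applies to `a`, `g`. -/
lemma thetaObj_shortExact (hD : IsRigid D) {S : ShortComplex (ModCat D.FullSubcategory)}
    (hS : S.ShortExact) :
    thetaObj hfin hD S.X₁ - thetaObj hfin hD S.X₂ + thetaObj hfin hD S.X₃ = 0 := by
  have := balanced_modCat hfin hD
  have := hS.mono_f
  have := hS.epi_g
  obtain ⟨E, hE, ⟨e₁⟩⟩ := exists_isPresented_iso hfin hD S.X₁
  obtain ⟨B, hB, ⟨e₂⟩⟩ := exists_isPresented_iso hfin hD S.X₂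
  obtain ⟨Z, -, ⟨e₃⟩⟩ := exists_isPresented_iso hfin hD S.X₃
  obtain ⟨f, hf⟩ := exists_map_eq hD hE (e₁.hom ≫ S.f ≫ e₂.inv)
  obtain ⟨g, hg⟩ := exists_map_eq hD hB (e₂.hom ≫ S.g ≫ e₃.inv)
  have : Mono ((H hfin).map f) := hf ▸ inferInstance
  have : Epi ((H hfin).map g) := hg ▸ inferInstance
  have hfm := isRelMono_of_mono (hfin := hfin) f
  have hge := isRelEpi_of_epi (hfin := hfin) g
  have hfg : IsGhost D (f ≫ g) := by
    rw [← H_map_eq_zero_iff (hfin := hfin), Functor.map_comp, hf, hg]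
    simp
  obtain ⟨A, a, t, hT⟩ := distinguished_cocone_triangle₁ g
  obtain ⟨P, p, hp⟩ := hfin A
  have hag : a ≫ g = 0 := comp_distTriang_mor_zero₁₂ _ hT
  have hw : ((H hfin).map (p ≫ a) ≫ e₂.hom) ≫ S.g = 0 := by
    have h₁ : (H hfin).map (p ≫ a) ≫ (H hfin).map g = 0 := by
      rw [← Functor.map_comp, H_map_eq_zero_iff, Category.assoc, hag, comp_zero]
      exact fun _ _ _ => comp_zero
    rw [hg] at h₁
    rw [← cancel_mono e₃.inv, zero_comp]
    simpa using h₁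
  -- Exactness makes `H (p ≫ a)` factor through the kernel; as `P` lies in `D`, the factorisation
  -- lifts to `C`.
  obtain ⟨s, hs⟩ := exists_map_eq_of_mem (hS.exact.lift _ hw ≫ e₁.inv) hp.1
  have hsf : s ≫ f = p ≫ a := by
    apply eq_of_H_map_eq (hfin := hfin) hp.1
    rw [Functor.map_comp, hs, hf]
    simp
  have hse : IsRelEpi D s := fun Y hY ξ => by
    obtain ⟨l, hl⟩ : ∃ l : Y ⟶ A, ξ ≫ f = l ≫ a :=
      Triangle.coyoneda_exact₂ _ hT (ξ ≫ f) ((Category.assoc _ _ _).trans (hfg Y hY ξ))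
    obtain ⟨m, rfl⟩ := hp.2 Y hY l
    refine ⟨m, sub_eq_zero.1 (hfm Y hY _ ?_)⟩
    rw [Preadditive.sub_comp, hl, Category.assoc, hsf, Category.assoc, sub_self]
  have h₁ : defect D a = defect D f := by
    rw [← defect_comp_of_isRelEpi hp.isRelEpi, ← hsf, defect_comp_of_isRelEpi hse]
  rw [thetaObj_eq hfin hD e₁, thetaObj_eq hfin hD e₂, thetaObj_eq hfin hD e₃,
    ← defect_of_isRelMono hfm, ← defect_of_isRelEpi hge, ← defect_add_defect hT, h₁]
  abel

/-- The homomorphism `θ : K₀(mod D) ⟶ K₀(C, E_D, s_D)`. -/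
noncomputable def theta (hD : IsRigid D) : AbK0 (ModCat D.FullSubcategory) →+ RelK0 D :=
  QuotientAddGroup.lift (exactRelations (ModCat D.FullSubcategory))
    (FreeAbelianGroup.lift (Quotient.lift (thetaObj hfin hD) fun M N ⟨e⟩ => by
      obtain ⟨A, -, ⟨a⟩⟩ := exists_isPresented_iso hfin hD M
      rw [thetaObj_eq hfin hD a, thetaObj_eq hfin hD (a ≪≫ e)])) (by
    refine (AddSubgroup.closure_le _).2 ?_
    rintro _ ⟨S, hS, rfl⟩
    refine AddMonoidHom.mem_ker.2 ?_
    simp only [freeClass, map_add, map_sub, FreeAbelianGroup.lift_apply_of]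
    exact thetaObj_shortExact hfin hD hS)

lemma theta_abClass (hD : IsRigid D) (M : ModCat D.FullSubcategory) :
    theta hfin hD (abClass M) = thetaObj hfin hD M :=
  FreeAbelianGroup.lift_apply_of _ _

lemma isTheta_theta (hD : IsRigid D) : IsTheta hfin (theta hfin hD) := fun A => by
  rw [theta_abClass, thetaObj_eq hfin hD (Iso.refl _)]

lemma abClass_eq_of_iso {A : Type*} [Category A] [HasZeroMorphisms A] {M N : A} (e : M ≅ N) :
    abClass M = abClass N := by
  have : freeClass M = freeClass N := congrArg FreeAbelianGroup.of (Quotient.sound ⟨e⟩)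
  simp only [abClass, this]

lemma IsTheta.ext (hD : IsRigid D) {θ θ' : AbK0 (ModCat D.FullSubcategory) →+ RelK0 D}
    (h : IsTheta hfin θ) (h' : IsTheta hfin θ') : θ = θ' := by
  apply QuotientAddGroup.addMonoidHom_ext
  apply FreeAbelianGroup.lift_ext
  rintro ⟨M⟩
  obtain ⟨A, -, ⟨a⟩⟩ := exists_isPresented_iso hfin hD M
  change θ (abClass M) = θ' (abClass M)
  rw [← abClass_eq_of_iso a, h, h']

variable {X : ObjectProperty C} (hX : X ≤ D)

lemma isZero_restrict_H_iff (A : C) :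
    IsZero (restrict hX ((H hfin).obj A)) ↔ ∀ (Y : C), X Y → ∀ ξ : Y ⟶ A, ξ = 0 := by
  rw [Functor.isZero_iff]
  constructor
  · intro h Y hY ξ
    have := AddCommGrpCat.subsingleton_of_isZero (h (op ⟨Y, hY⟩))
    exact this.elim ξ 0
  · intro h Y
    have : Subsingleton ((restrict hX ((H hfin).obj A)).obj Y) :=
      ⟨fun ξ η => (h _ Y.unop.property ξ).trans (h _ Y.unop.property η).symm⟩
    exact AddCommGrpCat.isZero_of_subsingleton _

lemma isZero_restrict_of_iso {L M : ModCat D.FullSubcategory} (e : L ≅ M)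
    (h : IsZero (restrict hX L)) : IsZero (restrict hX M) :=
  h.of_iso (Functor.isoWhiskerLeft _ ((finitelyPresented D.FullSubcategory).ι.mapIso e)).symm

lemma ker_Q (hD : IsRigid D) {θ : AbK0 (ModCat D.FullSubcategory) →+ RelK0 D}
    (hθ : IsTheta hfin θ) :
    (Q hX).ker = AddSubgroup.closure
      {x | ∃ L : ModCat D.FullSubcategory, IsZero (restrict hX L) ∧ x = θ (abClass L)} := by
  apply le_antisymm
  · intro x hx
    obtain ⟨y, rfl⟩ := QuotientAddGroup.mk_surjective x
    have hy : y ∈ conflationRelations X := (QuotientAddGroup.eq_zero_iff y).1 hx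
    change QuotientAddGroup.mk' (conflationRelations D) y ∈ _
    rw [← AddSubgroup.mem_comap]
    refine (AddSubgroup.closure_le _).2 ?_ hy
    rintro _ ⟨S, ⟨δ, hδ⟩, rfl⟩
    -- Here ΣX₂ appears as the cone of δ, so `defect δ` is exactly the conflation relation.
    have hT : Triangle.mk (δ : S.X₃ ⟶ S.X₁⟦(1 : ℤ)⟧) (-S.f⟦(1 : ℤ)⟧') (-S.g⟦(1 : ℤ)⟧') ∈
        distTriang C := rot_of_distTriang _ (rot_of_distTriang _ hδ)
    obtain ⟨P, E, p, q, m, hp, hq, hm, hpq⟩ :=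
      exists_image_factorisation hfin hD (δ : S.X₃ ⟶ S.X₁⟦(1 : ℤ)⟧)
    apply AddSubgroup.subset_closure
    -- `H E` is the image of `H δ`; it vanishes on `X` because δ does.
    refine ⟨(H hfin).obj E, (isZero_restrict_H_iff hfin hX E).2 fun Y hY ξ => ?_, ?_⟩
    · obtain ⟨η, rfl⟩ := hq Y (hX Y hY) ξ
      refine hm Y (hX Y hY) _ ?_
      rw [Category.assoc, ← hpq, ← Category.assoc]
      exact δ.2 Y hY _
    · rw [hθ, ← defect_of_isRelMono hm, ← defect_comp_of_isRelEpi hq, ← hpq,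
        defect_comp_of_isRelEpi hp, defect_eq hT,
        index_eq_of_iso (shiftShiftNeg S.X₁ (1 : ℤ)), index_eq_of_iso (shiftShiftNeg S.X₂ (1 : ℤ))]
      change index D S.X₁ - index D S.X₂ + index D S.X₃ = _
      abel
  · refine (AddSubgroup.closure_le _).2 ?_
    rintro _ ⟨L, hL, rfl⟩
    obtain ⟨A, -, ⟨a⟩⟩ := exists_isPresented_iso hfin hD L
    have hA := (isZero_restrict_H_iff hfin hX A).1 (isZero_restrict_of_iso hX a.symm hL)
    refine AddMonoidHom.mem_ker.2 ?_
    rw [← abClass_eq_of_iso a, hθ, map_add, Q_index, Q_index, ← defect_id]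
    -- Since `A` receives no nonzero map from `X`, its identity is an `X`-ghost; the contractible
    -- triangle then yields the relation.
    have : IsGhost X (𝟙 A) := fun Y hY ξ => by rw [hA Y hY ξ, zero_comp]
    have h := index_triangle_of_isGhost₁ (contractible_distinguished A) this
    rw [index_of_isZero (Functor.map_isZero _ (isZero_zero C)), sub_zero] at h
    rw [defect_id, add_comm, h]

end Theta

end FinitelyPresentedFunctors

end RelIndex

theorem mainTheorem3 {k : Type*} [Field k] {C : Type u} [Category.{v} C] [Preadditive C]
    [Linear k C] [∀ A B : C, FiniteDimensional k (A ⟶ B)]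
    [HasZeroObject C] [HasShift C ℤ] [∀ n : ℤ, (shiftFunctor C n).Additive]
    [Pretriangulated C] [IsTriangulated C] [IsIdempotentComplete C]
    (X T : ObjectProperty C) (hX : IsAdditiveSubcategory X) (hT : IsAdditiveSubcategory T)
    (hXfin : IsContravariantlyFinite X) (hTfin : IsContravariantlyFinite T)
    (hTrigid : IsRigid T) (hXT : X ≤ T) :
    (∃! θ : AbK0 (ModCat T.FullSubcategory) →+ RelK0 T, IsTheta hTfin θ) ∧
    ∀ θ : AbK0 (ModCat T.FullSubcategory) →+ RelK0 T, IsTheta hTfin θ →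
      (Q hXT).ker = AddSubgroup.closure
        {x | ∃ L : ModCat T.FullSubcategory, IsZero (restrict hXT L) ∧ x = θ (abClass L)} := by
  refine ⟨⟨theta hTfin hTrigid, isTheta_theta hTfin hTrigid, fun θ hθ =>
    hθ.ext hTfin hTrigid (isTheta_theta hTfin hTrigid)⟩, fun θ hθ => ?_⟩
  exact ker_Q hTfin hXT hTrigid hθ
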